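/- Throughout, rings are associative with identity and modules are unitary left modules. A submodule $N$ of a module $M$ is superfluous if $N+L=M$ for a submodule $L\subseteq M$ implies $L=M$. A projective cover of $M$ is a projective module $P$ together with an epimorphism $\pi:P\to M$ whose kernel is superfluous in $P$. A ring $R$ is perfect if every $R$-module $M$ has a projective cover; a choice of one is denoted $\pi_M:P_R(M)\to M$. A nonzero module $M$ is indecomposable if $M=N_1\oplus N_2$ with submodules $N_1,N_2$ implies $N_1=0$ or $N_2=0$. A module $M$ is sum-irreducible if $M=N_1+N_2$ with submodules $N_1,N_2$ implies $N_1=M$ or $N_2=M$. **Theorem 3.5 (= Theorem 1.1).** Let $R$ be a perfect ring and $P$ a nonzero $R$-module. The following assertions are equivalent: - (i) $P$ is indecomposable and projective. - (ii) $P$ is sum-irreducible and projective. - (iii) $P$ is the projective cover of each of its nonzero quotient modules, by means of the natural map: for every proper submodule $N\subsetneq P$, the natural epimorphism $P\to P/N$ is a projective cover of $P/N$. - (iii$'$) For every proper submodule $N\subsetneq P$ there is some homomorphism $P\to P/N$ that is a projective cover of $P/N$. - (iv) $P\cong P_R(R/\mathfrak m)$ for some maximal left ideal $\mathfrak m$ of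 $R$. If moreover $R$ is commutative, these assertions are also equivalent to: - (v) $P\cong R_{\mathfrak m}$ as $R$-modules for some maximal ideal $\mathfrak m$ of $R$. -/

import Mathlib

universe u v

/-- A submodule `N` of `M` is superfluous if `N + L = M` forces `L = M`. -/
def IsSuperfluous {R : Type u} [Ring R] {M : Type v} [AddCommGroup M] [Module R M]
    (N : Submodule R M) : Prop :=
  ∀ L : Submodule R M, N ⊔ L = ⊤ → L = ⊤

/-- `π : P → M` is a projective cover of `M`: the module `P` is projective, `π` is an epimorphism,
and its kernel is superfluous in `P`. -/
structure IsProjectiveCover {R : Type u} [Ring R] {P M : Type v} [AddCommGroup P] [Module R P]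
    [AddCommGroup M] [Module R M] (π : P →ₗ[R] M) : Prop where
  projective : Module.Projective R P
  surjective : Function.Surjective π
  superfluous : IsSuperfluous (LinearMap.ker π)

/-- A projective cover of `M`, as an object: a module together with a covering map onto `M`. -/
structure ProjectiveCover (R : Type u) [Ring R] (M : Type v) [AddCommGroup M] [Module R M] where
  carrier : Type v
  [addCommGroup : AddCommGroup carrier]
  [module : Module R carrier]
  π : carrier →ₗ[R] M
  isProjectiveCover : IsProjectiveCover π

attribute [instance] ProjectiveCover.addCommGroup ProjectiveCover.module

/-- A ring is (left) perfect if every left module has a projective cover. -/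
def IsPerfectRing (R : Type u) [Ring R] : Prop :=
  ∀ (M : Type u) [AddCommGroup M] [Module R M], Nonempty (ProjectiveCover R M)

/-- A choice `P_R(M)` of a projective cover of the module `M` over the perfect ring `R`. -/
noncomputable def IsPerfectRing.cover {R : Type u} [Ring R] (hR : IsPerfectRing R)
    (M : Type u) [AddCommGroup M] [Module R M] : ProjectiveCover R M :=
  (hR M).some

/-- A nonzero module is indecomposable if, whenever it is the internal direct sum of two
submodules, one of them is zero. -/
def IsIndecomposableModule (R : Type u) [Ring R] (M : Type v) [AddCommGroup M] [Module R M] :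
    Prop :=
  Nontrivial M ∧ ∀ N₁ N₂ : Submodule R M, IsCompl N₁ N₂ → N₁ = ⊥ ∨ N₂ = ⊥

/-- A module is sum-irreducible if, whenever it is the sum of two submodules, one of them is
the whole module. -/
def IsSumIrreducible (R : Type u) [Ring R] (M : Type v) [AddCommGroup M] [Module R M] : Prop :=
  ∀ N₁ N₂ : Submodule R M, N₁ ⊔ N₂ = ⊤ → N₁ = ⊤ ∨ N₂ = ⊤

/-! If `π : Q → M` is a projective cover of a simple module, every proper submodule of `Q` lies in
`ker π`; hence `Q` is sum-irreducible. Conversely, a nonzero projective module `P` has a maximal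
submodule `K`, so `P` maps onto the projective cover `Q` of the simple module `P ⧸ K`. This map
splits, and is therefore an isomorphism when `P` is indecomposable.

The existence of `K` is due to Bass: near a given element `x`, the identity of `P` factors through a
finite free module `F`. If `P` were its own radical, this would give an endomorphism of `F` with
values in the superfluous submodule `rad F` and with a fixed point that maps to `x`, whence `x = 0`.

Over a commutative ring, the elements outside `m` act bijectively on a projective cover `Q` of
`R ⧸ m`, and the annihilator of a generator of `Q` is killed by an element outside `m`; so `Q` is
the localization `R_m`. -/

universe w

section Superfluous

variable {R : Type u} [Ring R] {M : Type v} [AddCommGroup M] [Module R M]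
  {N : Type w} [AddCommGroup N] [Module R N]

theorem IsSuperfluous.mono {K L : Submodule R M} (hL : IsSuperfluous L) (hKL : K ≤ L) :
    IsSuperfluous K :=
  fun L' h ↦ hL L' (top_le_iff.mp (h ▸ sup_le_sup_right hKL L'))

theorem IsSuperfluous.surjective_of_comp {M' : Type*} [AddCommGroup M'] [Module R M']
    {π : M →ₗ[R] M'} (hπ : IsSuperfluous (LinearMap.ker π)) {f : N →ₗ[R] M}
    (hf : Function.Surjective (π ∘ₗ f)) : Function.Surjective f := by
  refine LinearMap.range_eq_top.mp (hπ _ ?_)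
  rw [sup_comm, ← Submodule.comap_map_eq, ← LinearMap.range_comp, LinearMap.range_eq_top.mpr hf,
    Submodule.comap_top]

theorem IsSuperfluous.le_of_isCoatom {K : Submodule R M} (hK : IsSuperfluous K)
    (hK' : IsCoatom K) {L : Submodule R M} (hL : L ≠ ⊤) : L ≤ K := by
  by_contra hLK
  exact hL (hK L (hK'.2 _ (left_lt_sup.mpr hLK)))

theorem isSuperfluous_jacobson [IsCoatomic (Submodule R M)] :
    IsSuperfluous (Module.jacobson R M) := by
  intro L hL
  refine (eq_top_or_exists_le_coatom L).resolve_right ?_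
  rintro ⟨K, hK, hLK⟩
  exact hK.1 (top_le_iff.mp (hL ▸ sup_le (sInf_le hK) hLK))

theorem IsSuperfluous.surjective_one_sub {f : Module.End R M}
    (hf : IsSuperfluous (LinearMap.range f)) : Function.Surjective (1 - f : Module.End R M) := by
  rw [← Submodule.ker_mkQ (LinearMap.range f)] at hf
  refine hf.surjective_of_comp ?_
  have hmkQ : (LinearMap.range f).mkQ ∘ₗ (1 - f) = (LinearMap.range f).mkQ := by
    ext x
    simp
  rw [hmkQ]
  exact Submodule.mkQ_surjective _

theorem IsSuperfluous.bijective_one_sub [Module.Projective R M] {f : Module.End R M}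
    (hf : IsSuperfluous (LinearMap.range f)) : Function.Bijective (1 - f : Module.End R M) := by
  obtain ⟨g, hg⟩ := LinearMap.exists_rightInverse_of_surjective _
    (LinearMap.range_eq_top.mpr hf.surjective_one_sub)
  have hleft : Function.LeftInverse (1 - f : Module.End R M) g := LinearMap.congr_fun hg
  -- `g` has the same shape as `1 - f`, so the section `g` is surjective as well.
  have hg_eq : g = 1 - f * -g := by
    rw [mul_neg, sub_neg_eq_add, ← sub_eq_iff_eq_add, ← one_sub_mul]
    exact hg
  have hg_surj : Function.Surjective g := by
    rw [hg_eq]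
    exact (hf.mono (LinearMap.range_comp_le_range _ _)).surjective_one_sub
  exact ⟨(hleft.rightInverse_of_surjective hg_surj).injective, hf.surjective_one_sub⟩

end Superfluous

section Bass

variable (R : Type u) [Ring R] (P : Type v) [AddCommGroup P] [Module R P] [Module.Projective R P]

variable {P} in
theorem exists_finite_free_comp_apply_eq_self (x : P) :
    ∃ (s : Finset P) (f : P →ₗ[R] s →₀ R) (g : (s →₀ R) →ₗ[R] P), g (f x) = x := by
  obtain ⟨σ, hσ⟩ := Module.projective_def.mp ‹Module.Projective R P›
  refine ⟨(σ x).support, Finsupp.lsubtypeDomain ((σ x).support : Set P) ∘ₗ σ,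
    Finsupp.linearCombination R Subtype.val, ?_⟩
  conv_rhs => rw [← hσ x]
  rw [Finsupp.linearCombination_apply, Finsupp.linearCombination_apply]
  exact Finsupp.sum_subtypeDomain_index (h := fun p r ↦ r • p) fun _ ↦ id

theorem exists_isCoatom_of_projective [Nontrivial P] : ∃ K : Submodule R P, IsCoatom K := by
  by_contra! hP
  have hrad : Module.jacobson R P = ⊤ := by
    rw [Module.jacobson, sInf_eq_top]
    exact fun K hK ↦ (hP K hK).elim
  obtain ⟨x, hx⟩ := exists_ne (0 : P)
  obtain ⟨s, f, g, hgf⟩ := exists_finite_free_comp_apply_eq_self R x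
  have hrange : LinearMap.range (f ∘ₗ g) ≤ Module.jacobson R (s →₀ R) :=
    calc LinearMap.range (f ∘ₗ g) ≤ LinearMap.range f := LinearMap.range_comp_le_range g f
      _ = (Module.jacobson R P).map f := by rw [hrad, LinearMap.range_eq_map]
      _ ≤ Module.jacobson R (s →₀ R) := Module.map_jacobson_le f
  have hinj := (isSuperfluous_jacobson.mono hrange).bijective_one_sub.injective
  have hfx : f x = 0 := hinj (by simp [hgf])
  exact hx (by rw [← hgf, hfx, map_zero])

end Bass

section Cover

variable {R : Type u} [Ring R] {M Q : Type v} [AddCommGroup M] [Module R M] [AddCommGroup Q]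
  [Module R Q] {P : Type w} [AddCommGroup P] [Module R P]

theorem IsSumIrreducible.isSuperfluous (h : IsSumIrreducible R P) {N : Submodule R P}
    (hN : N ≠ ⊤) : IsSuperfluous N :=
  fun L hL ↦ (h N L hL).resolve_left hN

theorem IsSumIrreducible.isProjectiveCover_mkQ [Module.Projective R P] (h : IsSumIrreducible R P)
    {N : Submodule R P} (hN : N ≠ ⊤) : IsProjectiveCover N.mkQ where
  projective := inferInstance
  surjective := N.mkQ_surjective
  superfluous := N.ker_mkQ.symm ▸ h.isSuperfluous hN

theorem IsSumIrreducible.isIndecomposableModule [Nontrivial P] (h : IsSumIrreducible R P) :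
    IsIndecomposableModule R P := by
  refine ⟨inferInstance, fun N₁ N₂ hN ↦ ?_⟩
  obtain rfl | rfl := h N₁ N₂ hN.sup_eq_top
  · exact .inr (top_disjoint.mp hN.disjoint)
  · exact .inl (disjoint_top.mp hN.disjoint)

theorem IsSumIrreducible.of_linearEquiv (h : IsSumIrreducible R Q) (e : P ≃ₗ[R] Q) :
    IsSumIrreducible R P := by
  intro N₁ N₂ hN
  have hmap : N₁.map (e : P →ₗ[R] Q) ⊔ N₂.map (e : P →ₗ[R] Q) = ⊤ := by
    rw [← Submodule.map_sup, hN, Submodule.map_top, LinearEquiv.range]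
  simpa only [Submodule.map_eq_top_iff] using h _ _ hmap

theorem IsProjectiveCover.le_ker_of_ne_top [IsSimpleModule R M] {π : Q →ₗ[R] M}
    (hπ : IsProjectiveCover π) {L : Submodule R Q} (hL : L ≠ ⊤) : L ≤ LinearMap.ker π :=
  hπ.superfluous.le_of_isCoatom (LinearMap.isCoatom_ker_of_surjective hπ.surjective) hL

theorem IsProjectiveCover.eq_top_of_mem [IsSimpleModule R M] {π : Q →ₗ[R] M}
    (hπ : IsProjectiveCover π) {x : Q} (hx : π x ≠ 0) {L : Submodule R Q} (hxL : x ∈ L) :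
    L = ⊤ :=
  not_imp_comm.mp hπ.le_ker_of_ne_top fun hL ↦ hx (hL hxL)

theorem IsProjectiveCover.isSumIrreducible [IsSimpleModule R M] {π : Q →ₗ[R] M}
    (hπ : IsProjectiveCover π) : IsSumIrreducible R Q := by
  intro N₁ N₂ hN
  by_contra! h
  have hker : LinearMap.ker π = ⊤ :=
    top_le_iff.mp (hN ▸ sup_le (hπ.le_ker_of_ne_top h.1) (hπ.le_ker_of_ne_top h.2))
  exact (LinearMap.isCoatom_ker_of_surjective hπ.surjective).1 hker

theorem IsIndecomposableModule.bijective_of_surjective {N : Type*} [AddCommGroup N] [Module R N]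
    [Module.Projective R N] [Nontrivial N] (hP : IsIndecomposableModule R P) {g : P →ₗ[R] N}
    (hg : Function.Surjective g) : Function.Bijective g := by
  obtain ⟨s, hs⟩ := g.exists_rightInverse_of_surjective (LinearMap.range_eq_top.mpr hg)
  have hgs (q : N) : g (s q) = q := LinearMap.congr_fun hs q
  have hidem : IsIdempotentElem (s ∘ₗ g : Module.End R P) := by
    ext p
    simp [hgs]
  obtain hrange | hker := hP.2 _ _ (LinearMap.IsIdempotentElem.isCompl hidem)
  · obtain ⟨q, hq⟩ := exists_ne (0 : N)
    obtain ⟨p, rfl⟩ := hg q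
    have hsg : s (g p) = 0 := LinearMap.congr_fun (LinearMap.range_eq_bot.mp hrange) p
    exact (hq (by rw [← hgs (g p), hsg, map_zero])).elim
  · exact ⟨Function.Injective.of_comp (LinearMap.ker_eq_bot.mp hker), hg⟩

theorem IsIndecomposableModule.nonempty_linearEquiv_of_isProjectiveCover [Module.Projective R P]
    (hP : IsIndecomposableModule R P) [Nontrivial M] {π : Q →ₗ[R] M} (hπ : IsProjectiveCover π)
    {f : P →ₗ[R] M} (hf : Function.Surjective f) : Nonempty (P ≃ₗ[R] Q) := by
  have := hπ.projective
  have := hπ.surjective.nontrivial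
  obtain ⟨g, rfl⟩ := Module.projective_lifting_property π f hπ.surjective
  exact ⟨.ofBijective g (hP.bijective_of_surjective (hπ.superfluous.surjective_of_comp hf))⟩

theorem isSimpleModule_quotient (m : Ideal R) [hm : m.IsMaximal] : IsSimpleModule R (R ⧸ m) :=
  isSimpleModule_iff_isCoatom.mpr (Ideal.isMaximal_def.mp hm)

theorem IsIndecomposableModule.exists_linearEquiv_cover [Module.Projective R P]
    (hP : IsIndecomposableModule R P)
    (cover : ∀ (m : Ideal R) [m.IsMaximal], ProjectiveCover R (R ⧸ m)) :
    ∃ (m : Ideal R) (_ : m.IsMaximal), Nonempty (P ≃ₗ[R] (cover m).carrier) := by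
  have := hP.1
  obtain ⟨K, hK⟩ := exists_isCoatom_of_projective R P
  obtain ⟨m, hm, ⟨e⟩⟩ := isSimpleModule_iff_quot_maximal.mp (isSimpleModule_iff_isCoatom.mpr hK)
  have := isSimpleModule_quotient m
  have := IsSimpleModule.nontrivial R (R ⧸ m)
  exact ⟨m, hm, hP.nonempty_linearEquiv_of_isProjectiveCover (cover m).isProjectiveCover
    (f := e ∘ₗ K.mkQ) (e.surjective.comp K.mkQ_surjective)⟩

end Cover

section Localization

variable {R : Type u} [CommRing R]

theorem IsProjectiveCover.bijective_algebraMap_end {M Q : Type v} [AddCommGroup M] [Module R M]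
    [AddCommGroup Q] [Module R Q] [IsSimpleModule R M] {π : Q →ₗ[R] M}
    (hπ : IsProjectiveCover π) {r : R} {x : Q} (hx : r • π x ≠ 0) :
    Function.Bijective (algebraMap R (Module.End R Q) r) := by
  have := hπ.projective
  have hx' : π (r • x) ≠ 0 := by rwa [map_smul]
  have : Nontrivial Q := nontrivial_of_ne (r • x) 0 fun h ↦ hx' (by rw [h, map_zero])
  refine hπ.isSumIrreducible.isIndecomposableModule.bijective_of_surjective ?_
  exact LinearMap.range_eq_top.mp (hπ.eq_top_of_mem hx' ⟨x, rfl⟩)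

variable {Q : Type u} [AddCommGroup Q] [Module R Q] {m : Ideal R} [m.IsMaximal] {π : Q →ₗ[R] R ⧸ m}

theorem IsProjectiveCover.isLocalizedModule_toSpanSingleton (hπ : IsProjectiveCover π) {x : Q}
    (hx : π x = 1) : IsLocalizedModule m.primeCompl (LinearMap.toSpanSingleton R Q x) := by
  have := hπ.projective
  have := isSimpleModule_quotient m
  have hsmul (r : R) : r • π x = Ideal.Quotient.mk m r := by
    rw [hx, ← Algebra.algebraMap_eq_smul_one, Ideal.Quotient.algebraMap_eq]
  have hsurj : Function.Surjective (LinearMap.toSpanSingleton R Q x) :=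
    LinearMap.range_eq_top.mp (hπ.eq_top_of_mem (hx ▸ one_ne_zero) ⟨1, one_smul R x⟩)
  obtain ⟨σ, hσ⟩ := LinearMap.exists_rightInverse_of_surjective _
    (LinearMap.range_eq_top.mpr hsurj)
  have hσx : σ x • x = x := LinearMap.congr_fun hσ x
  have hσm : σ x ∉ m := by
    rw [← Ideal.Quotient.eq_zero_iff_mem, ← hsmul, ← map_smul, hσx, hx]
    exact one_ne_zero
  refine ⟨fun r ↦ (Module.End.isUnit_iff _).mpr (hπ.bijective_algebraMap_end (x := x) ?_),
    fun y ↦ ?_, fun {r₁ r₂} h ↦ ⟨⟨σ x, hσm⟩, ?_⟩⟩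
  · rw [hsmul]
    exact mt Ideal.Quotient.eq_zero_iff_mem.mp r.2
  · obtain ⟨r, rfl⟩ := hsurj y
    exact ⟨(r, 1), one_smul _ _⟩
  · have hr : r₁ * σ x = r₂ * σ x := by simpa using congrArg σ h
    rwa [mul_comm, mul_comm r₂] at hr

theorem IsProjectiveCover.nonempty_linearEquiv_localization (hπ : IsProjectiveCover π) :
    Nonempty (Q ≃ₗ[R] Localization.AtPrime m) := by
  obtain ⟨x, hx⟩ := hπ.surjective 1
  have := hπ.isLocalizedModule_toSpanSingleton hx
  exact ⟨IsLocalizedModule.linearEquiv m.primeCompl (LinearMap.toSpanSingleton R Q x)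
    (Algebra.linearMap R (Localization.AtPrime m))⟩

end Localization

theorem tfae_isIndecomposableModule_projective {R : Type u} [Ring R]
    (cover : ∀ (m : Ideal R) [m.IsMaximal], ProjectiveCover R (R ⧸ m))
    (P : Type v) [AddCommGroup P] [Module R P] [Nontrivial P] :
    List.TFAE [
      IsIndecomposableModule R P ∧ Module.Projective R P,
      IsSumIrreducible R P ∧ Module.Projective R P,
      ∀ N : Submodule R P, N ≠ ⊤ → IsProjectiveCover N.mkQ,
      ∀ N : Submodule R P, N ≠ ⊤ → ∃ π : P →ₗ[R] P ⧸ N, IsProjectiveCover π,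
      ∃ (m : Ideal R) (_ : m.IsMaximal), Nonempty (P ≃ₗ[R] (cover m).carrier)] := by
  tfae_have 1 → 5 := fun ⟨h, _⟩ ↦ h.exists_linearEquiv_cover cover
  tfae_have 5 → 2 := by
    rintro ⟨m, hm, ⟨e⟩⟩
    have := isSimpleModule_quotient m
    have hcover := (cover m).isProjectiveCover
    have := hcover.projective
    exact ⟨hcover.isSumIrreducible.of_linearEquiv e, .of_equiv e.symm⟩
  tfae_have 2 → 3 := fun ⟨h, _⟩ _ hN ↦ h.isProjectiveCover_mkQ hN
  tfae_have 3 → 4 := fun h N hN ↦ ⟨N.mkQ, h N hN⟩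
  tfae_have 4 → 2 := by
    intro h
    obtain ⟨_, hbot⟩ := h ⊥ bot_ne_top
    have hP := hbot.projective
    obtain ⟨K, hK⟩ := exists_isCoatom_of_projective R P
    obtain ⟨π, hπ⟩ := h K hK.1
    have := isSimpleModule_iff_isCoatom.mpr hK
    exact ⟨hπ.isSumIrreducible, hP⟩
  tfae_have 2 → 1 := fun ⟨h, hP⟩ ↦ ⟨h.isIndecomposableModule, hP⟩
  tfae_finish

/-- A family `cover` as below exists exactly when `R` is semiperfect. -/
theorem theorem3p5_general :
    (∀ (R : Type u) [Ring R] (cover : ∀ (m : Ideal R) [m.IsMaximal], ProjectiveCover R (R ⧸ m))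
      (P : Type v) [AddCommGroup P] [Module R P] [Nontrivial P],
      List.TFAE [
        IsIndecomposableModule R P ∧ Module.Projective R P,
        IsSumIrreducible R P ∧ Module.Projective R P,
        ∀ N : Submodule R P, N ≠ ⊤ → IsProjectiveCover N.mkQ,
        ∀ N : Submodule R P, N ≠ ⊤ → ∃ π : P →ₗ[R] P ⧸ N, IsProjectiveCover π,
        ∃ (m : Ideal R) (_ : m.IsMaximal), Nonempty (P ≃ₗ[R] (cover m).carrier)]) ∧
    (∀ (R : Type u) [CommRing R]
      (cover : ∀ (m : Ideal R) [m.IsMaximal], ProjectiveCover R (R ⧸ m))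
      (P : Type v) [AddCommGroup P] [Module R P] [Nontrivial P],
      List.TFAE [
        IsIndecomposableModule R P ∧ Module.Projective R P,
        IsSumIrreducible R P ∧ Module.Projective R P,
        ∀ N : Submodule R P, N ≠ ⊤ → IsProjectiveCover N.mkQ,
        ∀ N : Submodule R P, N ≠ ⊤ → ∃ π : P →ₗ[R] P ⧸ N, IsProjectiveCover π,
        ∃ (m : Ideal R) (_ : m.IsMaximal), Nonempty (P ≃ₗ[R] (cover m).carrier),
        ∃ m : MaximalSpectrum R, Nonempty (P ≃ₗ[R] Localization.AtPrime m.asIdeal)]) := by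
  refine ⟨fun R _ cover P _ _ _ ↦ tfae_isIndecomposableModule_projective cover P,
    fun R _ cover P _ _ _ ↦ ?_⟩
  have h := tfae_isIndecomposableModule_projective cover P
  tfae_have 1 ↔ 2 := h.out 0 1
  tfae_have 1 ↔ 3 := h.out 0 2
  tfae_have 1 ↔ 4 := h.out 0 3
  tfae_have 1 ↔ 5 := h.out 0 4
  tfae_have 5 → 6 := by
    rintro ⟨m, hm, ⟨e⟩⟩
    obtain ⟨e'⟩ := (cover m).isProjectiveCover.nonempty_linearEquiv_localization
    exact ⟨⟨m, hm⟩, ⟨e.trans e'⟩⟩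
  tfae_have 6 → 5 := by
    rintro ⟨⟨m, hm⟩, ⟨e⟩⟩
    obtain ⟨e'⟩ := (cover m).isProjectiveCover.nonempty_linearEquiv_localization
    exact ⟨m, hm, ⟨e.trans e'.symm⟩⟩
  tfae_finish

theorem theorem3p5 :
    (∀ (R : Type u) [Ring R] (hR : IsPerfectRing R)
      (P : Type u) [AddCommGroup P] [Module R P] [Nontrivial P],
      List.TFAE [
        IsIndecomposableModule R P ∧ Module.Projective R P,
        IsSumIrreducible R P ∧ Module.Projective R P,
        ∀ N : Submodule R P, N ≠ ⊤ → IsProjectiveCover N.mkQ,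
        ∀ N : Submodule R P, N ≠ ⊤ → ∃ π : P →ₗ[R] P ⧸ N, IsProjectiveCover π,
        ∃ m : Ideal R, m.IsMaximal ∧ Nonempty (P ≃ₗ[R] (hR.cover (R ⧸ m)).carrier)]) ∧
    (∀ (R : Type u) [CommRing R] (hR : IsPerfectRing R)
      (P : Type u) [AddCommGroup P] [Module R P] [Nontrivial P],
      List.TFAE [
        IsIndecomposableModule R P ∧ Module.Projective R P,
        IsSumIrreducible R P ∧ Module.Projective R P,
        ∀ N : Submodule R P, N ≠ ⊤ → IsProjectiveCover N.mkQ,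
        ∀ N : Submodule R P, N ≠ ⊤ → ∃ π : P →ₗ[R] P ⧸ N, IsProjectiveCover π,
        ∃ m : Ideal R, m.IsMaximal ∧ Nonempty (P ≃ₗ[R] (hR.cover (R ⧸ m)).carrier),
        ∃ m : MaximalSpectrum R, Nonempty (P ≃ₗ[R] Localization.AtPrime m.asIdeal)]) := by
  refine ⟨fun R _ hR ↦ ?_, fun R _ hR ↦ ?_⟩
  · simpa only [exists_prop] using theorem3p5_general.1 R fun m _ ↦ hR.cover (R ⧸ m)
  · simpa only [exists_prop] using theorem3p5_general.2 R fun m _ ↦ hR.cover (R ⧸ m)
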